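/- **Setting.** There are $P\ge 1$ processors. Each processor owns finitely many (possibly zero) serial tasks whose sizes are positive integers; they are the leaves of a binary tree in which, at every node, the numbers of tasks on the two branches differ by at most one. Let $T_1$ be the total size of all serial tasks, and let $T_\infty=\lceil\lg P\rceil+T_\infty'+m$, where $T_\infty'$ is the largest height of one of the $P$ trees and $m$ is the size of the largest serial task (the height of the tree that joins the $P$ roots by a binary tree of height $\lceil\lg P\rceil$, plus the largest task size). The localized work-stealing algorithm proceeds in timesteps. Initially each processor holds its own tree and an empty list. In each timestep a processor that holds work executes one unit of the leftmost serial task of its tree. As long as some processor holds work, each free processor makes one steal attempt per timestep. If its list is non-empty, it makes a *steal-back* on a processor chosen uniformly at random from its list; otherwise it makes a *general steal* on a processor chosen uniformly at random among the processors that hold work. All choices in a timestep are independent. A successful steal takes the main branch of the victim's tree that the victim is not working on, and the thief starts working on it in the next timestep. A steal fails if the victim has no such branch, and a steal-back also fails if the victim is not working on tasks owned by the thief. If several thieves that could otherwise succeed attack the same victim, an arbitrary one of them (the choice may depend on the history and on the current choices) succeeds and the others fail. After an unsuccessful steal-back the owner removes the target from its list; after a successful general steal the thief is added to the list of the owner of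 the stolen tasks (unless it is that owner itself). **Theorem.** With high probability the number of steal-backs is at most $T_1+O(PT_\infty)$. That is: 1. In every execution, the number of successful steal-backs is at most $T_1$, and the number of unsuccessful steal-backs is at most the number of general steals. 2. For every $c>0$ there is a constant $C>0$, depending only on $c$, such that for every $P\ge1$, every input and every contention rule, the number of steal-backs is at most $T_1+C\,P\,T_\infty$ with probability at least $1-P^{-c}$. 3. There is an absolute constant $C>0$ such that for every $P\ge1$, every input, every contention rule and every $0<\varepsilon<1$, the number of steal-backs is at most $T_1+C\,P\,(T_\infty+\lg(1/\varepsilon))$ with probability at least $1-\varepsilon$. -/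

import Mathlib

namespace LocalizedWorkStealing

/-- A binary tree whose leaves are serial tasks. The number at a leaf is the size of the task,
i.e. the time needed to complete it (during an execution: the time that is still needed). -/
inductive Tree : Type
  | leaf (size : ℕ) : Tree
  | node (left right : Tree) : Tree

namespace Tree

/-- The number of edges on a longest path from the root to a leaf. -/
def height : Tree → ℕ
  | leaf _ => 0
  | node l r => max l.height r.height + 1

/-- The number of serial tasks. -/
def numTasks : Tree → ℕ
  | leaf _ => 1
  | node l r => l.numTasks + r.numTasks

/-- The sum of the sizes of the serial tasks. -/
def work : Tree → ℕ
  | leaf s => s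
  | node l r => l.work + r.work

/-- The size of the largest serial task. -/
def maxSize : Tree → ℕ
  | leaf s => s
  | node l r => max l.maxSize r.maxSize

/-- Every serial task has positive size. -/
def Positive : Tree → Prop
  | leaf s => 0 < s
  | node l r => l.Positive ∧ r.Positive

/-- At every node the numbers of serial tasks on the two branches differ by at most one. -/
def Balanced : Tree → Prop
  | leaf _ => True
  | node l r => l.numTasks ≤ r.numTasks + 1 ∧ r.numTasks ≤ l.numTasks + 1 ∧
      l.Balanced ∧ r.Balanced

/-- What remains of a tree after its processor has worked on it for one timestep. The serial tasks
are executed one after the other from left to right; `none` means that everything is done. -/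
def workOneStep : Tree → Option Tree
  | leaf s => if s ≤ 1 then none else some (leaf (s - 1))
  | node l r =>
    match l.workOneStep with
    | none => some r
    | some l' => some (node l' r)

/-- The branch that a thief takes away: the main branch that the processor is not working on.
There is none if only a single serial task (the one being executed) is left. -/
def stolenBranch : Tree → Option Tree
  | leaf _ => none
  | node _ r => some r

/-- What a successful steal leaves to the victim. -/
def keptBranch : Tree → Tree
  | leaf s => leaf s
  | node l _ => l

end Tree

/-- The input for `P` processors: each processor owns a (possibly empty) collection of serial
tasks, arranged as the leaves of a balanced binary tree. -/
structure Computation (P : ℕ) where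
  tree : Fin P → Option Tree
  positive : ∀ i, ∀ t ∈ tree i, t.Positive
  balanced : ∀ i, ∀ t ∈ tree i, t.Balanced

namespace Computation

variable {P : ℕ}

/-- The work `T₁`: the total size of all serial tasks. -/
def work (W : Computation P) : ℕ :=
  ∑ i, (W.tree i).elim 0 Tree.work

/-- The height `T_∞'` of the forest of the trees of the individual processors. -/
def forestHeight (W : Computation P) : ℕ :=
  Finset.univ.sup fun i => (W.tree i).elim 0 Tree.height

/-- The size of the largest serial task. -/
def maxSize (W : Computation P) : ℕ :=
  Finset.univ.sup fun i => (W.tree i).elim 0 Tree.maxSize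

/-- The span `T_∞`: the height of the tree obtained by joining the `P` roots through a binary tree
of height `⌈lg P⌉`, plus the size of the largest serial task. -/
def span (W : Computation P) : ℕ :=
  Nat.clog 2 P + W.forestHeight + W.maxSize

end Computation

/-- A configuration of the localized work-stealing algorithm, with counters for the steal attempts
made so far. -/
structure State (P : ℕ) where
  /-- `job i = some (o, t)`: processor `i` is working on the tree `t`, whose serial tasks are owned
  by `o`. `job i = none`: processor `i` is free. -/
  job : Fin P → Option (Fin P × Tree)
  /-- The list kept by each processor of the other processors that are working on its work. -/
  helpers : Fin P → Finset (Fin P)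
  /-- General steal attempts. -/
  generalSteals : ℕ
  /-- Successful steal-backs. -/
  successfulStealBacks : ℕ
  /-- Unsuccessful steal-backs. -/
  unsuccessfulStealBacks : ℕ

namespace State

variable {P : ℕ}

/-- The number of steal-backs so far, successful or not. -/
def stealBacks (s : State P) : ℕ :=
  s.successfulStealBacks + s.unsuccessfulStealBacks

/-- The processors that have work left to do. -/
def busy (s : State P) : Finset (Fin P) :=
  Finset.univ.filter fun i => (s.job i).isSome

/-- The free processors that make a steal-back in the next timestep: those with a non-empty list.
No attempts are made any more when all work is done. -/
def backThieves (s : State P) : Finset (Fin P) :=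
  Finset.univ.filter fun i => s.busy.Nonempty ∧ i ∉ s.busy ∧ (s.helpers i).Nonempty

/-- The free processors that make a general steal in the next timestep. -/
def generalThieves (s : State P) : Finset (Fin P) :=
  Finset.univ.filter fun i => s.busy.Nonempty ∧ i ∉ s.busy ∧ ¬ (s.helpers i).Nonempty

/-- The processors among which processor `i` chooses its victim uniformly at random: the
processors on its list for a steal-back, all processors with work left for a general steal.
A processor that makes no attempt gets the dummy choice `i`. -/
def targets (s : State P) (i : Fin P) : Finset (Fin P) :=
  if i ∈ s.backThieves then s.helpers i
  else if i ∈ s.generalThieves then s.busy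
  else {i}

theorem targets_nonempty (s : State P) (i : Fin P) : (s.targets i).Nonempty := by
  unfold targets
  split_ifs with h₁ h₂
  · exact (Finset.mem_filter.mp h₁).2.2.2
  · exact (Finset.mem_filter.mp h₂).2.1
  · exact Finset.singleton_nonempty i

/-- The owner of the work that processor `j` is working on. -/
def owner (s : State P) (j : Fin P) : Option (Fin P) := (s.job j).map Prod.fst

/-- The branch that can be stolen from processor `j`, together with its owner. -/
def loot (s : State P) (j : Fin P) : Option (Fin P × Tree) :=
  (s.job j).bind fun x => x.2.stolenBranch.map fun t => (x.1, t)

/-- Given the victims `v` chosen by the processors, the thieves that compete for the branch of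
processor `j`: all general thieves that chose `j`, and the owner of the work of `j` if it steals
back from `j`. There are none if `j` has nothing to be stolen. -/
def contenders (s : State P) (v : Fin P → Fin P) (j : Fin P) : Finset (Fin P) :=
  Finset.univ.filter fun i => v i = j ∧ (s.loot j).isSome ∧
    (i ∈ s.generalThieves ∨ (i ∈ s.backThieves ∧ s.owner j = some i))

/-- The thieves that succeed, where `w j` is the winner of the contention at `j`. -/
def winners (s : State P) (v w : Fin P → Fin P) : Finset (Fin P) :=
  Finset.univ.filter fun i => i ∈ s.contenders v (v i) ∧ w (v i) = i

/-- One timestep, in which the processors choose the victims `v` and `w j` wins at `j`. Every free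
processor makes one steal attempt (if there is work left at all); every busy processor works for
one unit of time on what the thieves leave to it. An owner removes the target of an unsuccessful
steal-back from its list; a successful general thief is added to the list of the owner of the
work that it has stolen. -/
def next (s : State P) (v w : Fin P → Fin P) : State P where
  job i :=
    match s.job i with
    | some (o, t) =>
      (if (s.contenders v i).Nonempty then t.keptBranch else t).workOneStep.map fun t' => (o, t')
    | none => if i ∈ s.winners v w then s.loot (v i) else none
  helpers o :=
    (if o ∈ s.backThieves \ s.winners v w then (s.helpers o).erase (v o) else s.helpers o) ∪
      (s.generalThieves ∩ s.winners v w).filter fun i => s.owner (v i) = some o ∧ i ≠ o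
  generalSteals := s.generalSteals + s.generalThieves.card
  successfulStealBacks := s.successfulStealBacks + (s.backThieves ∩ s.winners v w).card
  unsuccessfulStealBacks := s.unsuccessfulStealBacks + (s.backThieves \ s.winners v w).card

/-- The law of the choices in one timestep: each processor chooses uniformly from its targets,
independently of the others (the uniform law on the product of the target sets). -/
noncomputable def choiceLaw (s : State P) : PMF (Fin P → Fin P) :=
  PMF.uniformOfFinset (Fintype.piFinset s.targets)
    (Fintype.piFinset_nonempty.mpr s.targets_nonempty)

end State

/-- The choices made in the past timesteps, the most recent one first. -/
abbrev History (P : ℕ) : Type := List (Fin P → Fin P)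

/-- An arbitrary rule that decides which one of several simultaneous thieves succeeds. It may
depend on the past, on the current choices and on the victim. -/
structure ContentionRule (P : ℕ) where
  pick : History P → (Fin P → Fin P) → Fin P → Finset (Fin P) → Fin P
  pick_mem : ∀ h v j (A : Finset (Fin P)), A.Nonempty → pick h v j A ∈ A

variable {P : ℕ}

/-- At the beginning every processor has its own tree, and all lists are empty. -/
def initial (W : Computation P) : State P where
  job i := (W.tree i).map fun t => (i, t)
  helpers _ := ∅
  generalSteals := 0
  successfulStealBacks := 0
  unsuccessfulStealBacks := 0

/-- The configuration reached after a given history. -/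
def stateAfter (W : Computation P) (R : ContentionRule P) : History P → State P
  | [] => initial W
  | v :: h =>
    let s := stateAfter W R h
    s.next v fun j => R.pick h v j (s.contenders v j)

/-- The law of the choices in the first `n` timesteps of the execution. -/
noncomputable def historyLaw (W : Computation P) (R : ContentionRule P) : ℕ → PMF (History P)
  | 0 => PMF.pure []
  | n + 1 => (historyLaw W R n).bind fun h =>
      (stateAfter W R h).choiceLaw.map fun v => v :: h

/-- The law of the number of steal-backs in the first `n` timesteps. This number does not decrease
with `n`, and does not change any more once all work is done. -/
noncomputable def stealBackLaw (W : Computation P) (R : ContentionRule P) (n : ℕ) : PMF ℕ :=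
  (historyLaw W R n).map fun h => (stateAfter W R h).stealBacks

end LocalizedWorkStealing

/-! Two deterministic accounts reduce the theorem to a tail bound on the number of general steals.
First, a successful steal cuts a tree into two nonempty trees, so the sum of `load - 1` over the
trees in progress drops by at least one with each success. That sum is at most `T₁` at the start,
which pays for the successful steal-backs (`successfulStealBacks_add_total_next_le`). Second, an
unsuccessful steal-back erases a list entry, and every entry was created by a general steal of its
own (`unsuccessfulStealBacks_add_helpers_next_le`).

General steals are bounded through the potential `Φ = ∑ 4 ^ level`. A tree that loses a branch
keeps, together with that branch, at most half of its potential; a tree that is a single task halves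
its potential by executing one unit; every other tree at least does not gain. With `b` busy
processors and `g` general thieves, a given busy processor is missed by all of them with probability
`(1 - 1/b) ^ g ≤ b / (b + g) ≤ 1 - g / P`. Hence the expected potential shrinks by a factor of at
least `1 - g / (2 P) ≤ exp (-g / (2 P))` (`sum_max_one_potential_next_le`).

With `G` the number of general steals so far, `max 1 Φ * exp (G / (2 P))` is therefore a
supermartingale, whatever the contention rule does (`tsum_historyLaw_mul_weight_le`). It starts at
no more than `exp (2 T_∞)` and always dominates `exp (G / (2 P))`, so Markov's inequality gives the
tail of `G`. -/

namespace LocalizedWorkStealing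

open Finset

/-! ### Effect of work and of a steal on a single tree -/

namespace Tree

/-- The largest number of steps (down an edge, or a unit of work) on a path from the root to the
end of a serial task. -/
def level : Tree → ℕ
  | leaf s => max s 1
  | node l r => max l.level r.level + 1

/-- The work of a tree, where every serial task counts at least one. -/
def load : Tree → ℕ
  | leaf s => max s 1
  | node l r => l.load + r.load

theorem one_le_level (t : Tree) : 1 ≤ t.level := by
  cases t <;> simp [level]

theorem one_le_load (t : Tree) : 1 ≤ t.load := by
  induction t with
  | leaf s => simp [load]
  | node l r hl hr => simp only [load]; omega

theorem load_eq_work {t : Tree} (h : t.Positive) : t.load = t.work := by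
  induction t with
  | leaf s => simp only [Positive] at h; simp only [load, work]; omega
  | node l r hl hr => simp only [load, work, hl h.1, hr h.2]

theorem level_le_height_add_maxSize {t : Tree} (h : t.Positive) :
    t.level ≤ t.height + t.maxSize := by
  induction t with
  | leaf s => simp only [Positive] at h; simp only [level, height, maxSize]; omega
  | node l r hl hr =>
    have h₁ := hl h.1
    have h₂ := hr h.2
    simp only [level, height, maxSize]
    omega

theorem level_le_of_mem_workOneStep {t t' : Tree} (h : t.workOneStep = some t') :
    t'.level ≤ t.level := by
  induction t generalizing t' with
  | leaf s =>
    simp only [workOneStep] at h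
    split_ifs at h
    cases h
    simp only [level]
    omega
  | node l r hl hr =>
    simp only [workOneStep] at h
    split at h
    · cases h
      simp only [level]
      omega
    · rename_i l' hl'
      cases h
      have := hl hl'
      simp only [level]
      omega

theorem load_lt_of_mem_workOneStep {t t' : Tree} (h : t.workOneStep = some t') :
    t'.load < t.load := by
  induction t generalizing t' with
  | leaf s =>
    simp only [workOneStep] at h
    split_ifs at h
    cases h
    simp only [load]
    omega
  | node l r hl hr =>
    simp only [workOneStep] at h
    split at h
    · cases h
      have := one_le_load l
      simp only [load]
      omega
    · rename_i l' hl'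
      cases h
      have := hl hl'
      simp only [load]
      omega

theorem elim_workOneStep_pow_level_le (t : Tree) :
    t.workOneStep.elim 0 (fun t' => 4 ^ t'.level) ≤ 4 ^ t.level := by
  cases h : t.workOneStep with
  | none => simp
  | some t' => exact Nat.pow_le_pow_right (by norm_num) (level_le_of_mem_workOneStep h)

theorem elim_workOneStep_load_le (t : Tree) :
    t.workOneStep.elim 0 (fun t' => t'.load - 1) ≤ t.load - 1 := by
  cases h : t.workOneStep with
  | none => simp
  | some t' => exact Nat.sub_le_sub_right (load_lt_of_mem_workOneStep h).le 1

/-- Cutting a load `a + b` into `a` and `b` turns `a + b - 1` into `(a - 1) + (b - 1)`. The missing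
unit pays for the steal. -/
theorem elim_workOneStep_load_le_kept_stolen {t u : Tree} (h : t.stolenBranch = some u) :
    t.keptBranch.workOneStep.elim 0 (fun t' => t'.load - 1) + (u.load - 1 + 1) ≤ t.load - 1 := by
  cases t with
  | leaf s => simp [stolenBranch] at h
  | node l r =>
    simp only [stolenBranch, Option.some.injEq] at h
    subst h
    have h₁ := elim_workOneStep_load_le l
    have h₂ := one_le_load l
    have h₃ := one_le_load r
    simp only [keptBranch, load]
    omega

/-- A steal leaves at most half of the potential. -/
theorem pow_level_kept_add_stolen_le {t u : Tree} (h : t.stolenBranch = some u) :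
    2 * (t.keptBranch.workOneStep.elim 0 (fun t' => 4 ^ t'.level) + 4 ^ u.level) ≤
      4 ^ t.level := by
  cases t with
  | leaf s => simp [stolenBranch] at h
  | node l r =>
    simp only [stolenBranch, Option.some.injEq] at h
    subst h
    have h₁ := elim_workOneStep_pow_level_le l
    have h₂ : 4 ^ l.level ≤ 4 ^ max l.level r.level :=
      Nat.pow_le_pow_right (by norm_num) (le_max_left _ _)
    have h₃ : 4 ^ r.level ≤ 4 ^ max l.level r.level :=
      Nat.pow_le_pow_right (by norm_num) (le_max_right _ _)
    -- Each of the two branches has at most a quarter of the potential of the node; this is why the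
    -- base is 4.
    simp only [keptBranch, level, pow_succ]
    omega

/-- Working on a single serial task leaves at most half of the potential. -/
theorem pow_level_workOneStep_le_of_stolenBranch_eq_none {t : Tree} (h : t.stolenBranch = none) :
    2 * t.workOneStep.elim 0 (fun t' => 4 ^ t'.level) ≤ 4 ^ t.level := by
  cases t with
  | node l r => simp [stolenBranch] at h
  | leaf s =>
    simp only [workOneStep]
    split_ifs with hs
    · simp
    · simp only [Option.elim, level]
      -- The task survives, so `s ≥ 2` and the truncation at one in `level` is inactive before and
      -- after the step.
      rw [max_eq_left (by omega : 1 ≤ s - 1), max_eq_left (by omega : 1 ≤ s)]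
      obtain ⟨k, rfl⟩ : ∃ k, s = k + 1 := ⟨s - 1, by omega⟩
      simp only [Nat.add_sub_cancel, pow_succ]
      omega

end Tree

/-! ### Deterministic accounting in one timestep -/

namespace State

variable {P : ℕ}

/-- The sum of `f` over the trees that the processors are working on. -/
def total (f : Tree → ℕ) (s : State P) : ℕ := ∑ i, (s.job i).elim 0 fun x => f x.2

/-- A victim has only one winner, so `v` is injective on the winners and whatever they gain can be
charged to distinct contended victims. -/
theorem sum_winners_le (s : State P) (v w : Fin P → Fin P) (F : Fin P → ℕ) :
    ∑ i ∈ s.winners v w, F (v i) ≤ ∑ j with (s.contenders v j).Nonempty, F j := by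
  have hinj : Set.InjOn v (s.winners v w) := by
    intro a ha b hb hab
    have ha' := (mem_filter.mp ha).2.2
    have hb' := (mem_filter.mp hb).2.2
    rw [← ha', ← hb', hab]
  rw [← sum_image (f := F) hinj]
  refine sum_le_sum_of_subset fun j hj => ?_
  obtain ⟨i, hi, rfl⟩ := mem_image.mp hj
  exact mem_filter.mpr ⟨mem_univ _, i, (mem_filter.mp hi).2.1⟩

theorem not_busy_of_mem_winners {s : State P} {v w : Fin P → Fin P} {i : Fin P}
    (hi : i ∈ s.winners v w) : s.job i = none := by
  have h := (mem_filter.mp (mem_filter.mp hi).2.1).2.2.2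
  have hb : i ∉ s.busy := by
    rcases h with h | h
    · exact (mem_filter.mp h).2.2.1
    · exact (mem_filter.mp h.1).2.2.1
  simpa [busy] using hb

/-- What remains after one timestep of the work of a processor, including the stolen branch,
measured by `f`. Every successful steal counts an extra `c`. -/
theorem total_next_add_le (s : State P) (v w : Fin P → Fin P) (f : Tree → ℕ) (c : ℕ) :
    (s.next v w).total f + (s.winners v w).card * c ≤
      ∑ i, (s.job i).elim 0 fun x =>
        if (s.contenders v i).Nonempty then
          x.2.keptBranch.workOneStep.elim 0 f + x.2.stolenBranch.elim 0 fun u => f u + c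
        else x.2.workOneStep.elim 0 f := by
  have h₁ : (s.next v w).total f ≤
      (∑ i, (s.job i).elim 0 fun x =>
        (if (s.contenders v i).Nonempty then x.2.keptBranch else x.2).workOneStep.elim 0 f) +
      ∑ i ∈ s.winners v w, (s.loot (v i)).elim 0 fun x => f x.2 := by
    -- Winners were free before the step, so afterwards they hold exactly their loot; the remaining
    -- processors hold at most what is left of their own trees.
    rw [← sum_filter_add_sum_filter_not univ (· ∈ s.winners v w)
      (fun i => (s.job i).elim 0 _)]
    unfold total
    rw [← sum_filter_add_sum_filter_not univ (· ∈ s.winners v w)]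
    have e : ({x | x ∈ s.winners v w} : Finset (Fin P)) = s.winners v w := by ext; simp
    rw [e]
    have k₁ : ∑ i ∈ s.winners v w, (((s.next v w).job i).elim 0 fun x => f x.2) =
        ∑ i ∈ s.winners v w, (s.loot (v i)).elim 0 fun x => f x.2 := by
      refine sum_congr rfl fun i hi => ?_
      simp only [next, not_busy_of_mem_winners hi, hi, if_true]
    rw [k₁, add_comm]
    refine Nat.add_le_add_right (le_trans (sum_le_sum fun i hi => ?_) (Nat.le_add_left _ _)) _
    have hi' := (mem_filter.mp hi).2
    cases hj : s.job i with
    | none => simp [next, hj, hi']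
    | some x =>
      obtain ⟨o, t⟩ := x
      simp only [next, hj, Option.elim_some]
      cases (if (s.contenders v i).Nonempty then t.keptBranch else t).workOneStep <;> simp
  -- The loot and the extra `c` are moved from the thief to the victim, so that the rest of the
  -- argument is local to each tree.
  have h₂ := s.sum_winners_le v w fun j => ((s.loot j).elim 0 fun x => f x.2) + c
  rw [sum_add_distrib, sum_const, smul_eq_mul] at h₂
  refine le_trans (Nat.add_le_add_right h₁ _) ?_
  rw [add_assoc]
  refine le_trans (Nat.add_le_add_left h₂ _) ?_
  rw [sum_filter, ← sum_add_distrib]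
  refine sum_le_sum fun i _ => ?_
  cases hj : s.job i with
  | none =>
    have : ¬ (s.contenders v i).Nonempty := by
      rintro ⟨k, hk⟩
      have := (mem_filter.mp hk).2.2.1
      simp [loot, hj] at this
    simp [this]
  | some x =>
    obtain ⟨o, t⟩ := x
    by_cases hc : (s.contenders v i).Nonempty
    · obtain ⟨k, hk⟩ := id hc
      have hl := (mem_filter.mp hk).2.2.1
      simp only [loot, hj, Option.bind_some, Option.isSome_map] at hl
      obtain ⟨u, hu⟩ := Option.isSome_iff_exists.mp hl
      simp [hc, loot, hj, hu]
    · simp [hc]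

theorem exists_stolenBranch_of_contenders {s : State P} {v : Fin P → Fin P} {i o : Fin P}
    {t : Tree} (hj : s.job i = some (o, t)) (hc : (s.contenders v i).Nonempty) :
    ∃ u, t.stolenBranch = some u := by
  obtain ⟨k, hk⟩ := hc
  have hl := (mem_filter.mp hk).2.2.1
  simp only [loot, hj, Option.bind_some, Option.isSome_map] at hl
  exact Option.isSome_iff_exists.mp hl

theorem successfulStealBacks_add_total_next_le (s : State P) (v w : Fin P → Fin P) :
    (s.next v w).successfulStealBacks + (s.next v w).total (fun t => t.load - 1) ≤
      s.successfulStealBacks + s.total fun t => t.load - 1 := by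
  have h := s.total_next_add_le v w (fun t => t.load - 1) 1
  have h₁ : (s.backThieves ∩ s.winners v w).card ≤ (s.winners v w).card :=
    card_le_card inter_subset_right
  have h₂ : (∑ i, (s.job i).elim 0 fun x =>
        if (s.contenders v i).Nonempty then
          x.2.keptBranch.workOneStep.elim 0 (fun t => t.load - 1) +
            x.2.stolenBranch.elim 0 fun u => u.load - 1 + 1
        else x.2.workOneStep.elim 0 fun t => t.load - 1) ≤ s.total fun t => t.load - 1 := by
    refine sum_le_sum fun i _ => ?_
    cases hj : s.job i with
    | none => simp
    | some x =>
      obtain ⟨o, t⟩ := x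
      simp only [Option.elim_some]
      split_ifs with hc
      · obtain ⟨u, hu⟩ := exists_stolenBranch_of_contenders hj hc
        rw [hu]
        exact Tree.elim_workOneStep_load_le_kept_stolen hu
      · exact t.elim_workOneStep_load_le
  have h₃ : (s.next v w).successfulStealBacks =
      s.successfulStealBacks + (s.backThieves ∩ s.winners v w).card := rfl
  omega

/-- List entries serve as credit: a failed steal-back spends the entry that it erases, and a general
steal creates at most one entry. -/
theorem unsuccessfulStealBacks_add_helpers_next_le (s : State P) (v w : Fin P → Fin P)
    (hv : ∀ i, v i ∈ s.targets i)
    (h : s.unsuccessfulStealBacks + ∑ o, (s.helpers o).card ≤ s.generalSteals) :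
    (s.next v w).unsuccessfulStealBacks + ∑ o, ((s.next v w).helpers o).card ≤
      (s.next v w).generalSteals := by
  have h₁ : (∑ o, ((s.next v w).helpers o).card) + (s.backThieves \ s.winners v w).card ≤
      (∑ o, (s.helpers o).card) +
      ∑ o, ((s.generalThieves ∩ s.winners v w).filter
        fun i => s.owner (v i) = some o ∧ i ≠ o).card := by
    have e : (s.backThieves \ s.winners v w).card =
        ∑ o, if o ∈ s.backThieves \ s.winners v w then 1 else 0 := by
      rw [sum_ite_mem, univ_inter, sum_const, smul_eq_mul, mul_one]
    rw [e, ← sum_add_distrib, ← sum_add_distrib]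
    refine sum_le_sum fun o _ => ?_
    refine le_trans (Nat.add_le_add_right (card_union_le _ _) _) ?_
    by_cases ho : o ∈ s.backThieves \ s.winners v w
    · have hb := (mem_sdiff.mp ho).1
      -- The erasure really shortens the list, since a steal-back chooses its target from it.
      have hm : v o ∈ s.helpers o := by
        have := hv o
        rwa [targets, if_pos hb] at this
      have := card_erase_add_one hm
      simp only [if_pos ho]
      omega
    · simp only [if_neg ho]
      omega
  have h₂ : ∑ o, ((s.generalThieves ∩ s.winners v w).filter
        fun i => s.owner (v i) = some o ∧ i ≠ o).card ≤ s.generalThieves.card := by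
    -- Stolen work has a single owner, so each general thief enters at most one list.
    rw [← card_biUnion]
    · refine card_le_card fun i hi => ?_
      obtain ⟨o, -, ho⟩ := mem_biUnion.mp hi
      exact (mem_inter.mp (mem_filter.mp ho).1).1
    · intro a _ b _ hab
      refine disjoint_left.mpr fun i hi hi' => hab ?_
      have := (mem_filter.mp hi).2.1.symm.trans (mem_filter.mp hi').2.1
      exact Option.some.inj this
  have h₃ : (s.next v w).unsuccessfulStealBacks =
      s.unsuccessfulStealBacks + (s.backThieves \ s.winners v w).card := rfl
  have h₄ : (s.next v w).generalSteals = s.generalSteals + s.generalThieves.card := rfl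
  omega

/-! ### Probability that a busy processor escapes all general thieves -/

theorem targets_of_mem_generalThieves {s : State P} {i : Fin P} (hi : i ∈ s.generalThieves) :
    s.targets i = s.busy := by
  have h : i ∉ s.backThieves := fun hb => (mem_filter.mp hi).2.2.2 (mem_filter.mp hb).2.2.2
  rw [targets, if_neg h, if_pos hi]

theorem card_busy_add_card_generalThieves_le (s : State P) :
    s.busy.card + s.generalThieves.card ≤ P := by
  rw [← card_union_of_disjoint]
  · simpa using card_le_univ (s.busy ∪ s.generalThieves)
  · exact disjoint_right.mpr fun i hi => (mem_filter.mp hi).2.2.1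

/-- The choices in which no general thief attacks `j`. -/
def avoiding (s : State P) (j : Fin P) : Finset (Fin P → Fin P) :=
  (Fintype.piFinset s.targets).filter fun v => ∀ i ∈ s.generalThieves, v i ≠ j

/-- By independence the avoiding choices again form a product set, in which each general thief has
lost the one option `j`. Cross-multiplied, this says that the probability of escape is `(1 - 1/b) ^
g`. -/
theorem card_avoiding_mul_pow (s : State P) {j : Fin P} (hj : j ∈ s.busy) :
    (s.avoiding j).card * s.busy.card ^ s.generalThieves.card =
      (Fintype.piFinset s.targets).card * (s.busy.card - 1) ^ s.generalThieves.card := by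
  have h : s.avoiding j = Fintype.piFinset fun i =>
      if i ∈ s.generalThieves then s.busy.erase j else s.targets i := by
    ext v
    simp only [avoiding, mem_filter, Fintype.mem_piFinset, ← forall_and]
    refine forall_congr' fun i => ?_
    split_ifs with hi
    · rw [targets_of_mem_generalThieves hi, mem_erase]
      tauto
    · tauto
  rw [h, Fintype.card_piFinset, Fintype.card_piFinset, ← prod_const, ← prod_const]
  have e (c : ℕ) : ∏ _i ∈ s.generalThieves, c = ∏ i, if i ∈ s.generalThieves then c else 1 := by
    rw [prod_ite_mem, univ_inter]
  rw [e, e, ← prod_mul_distrib, ← prod_mul_distrib]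
  refine prod_congr rfl fun i _ => ?_
  split_ifs with hi
  · rw [targets_of_mem_generalThieves hi, card_erase_of_mem hj, mul_comm]
  · rfl

/-- A form of Bernoulli's inequality: with `n = b + 1` it reads `(1 - 1/n) ^ g ≤ n / (n + g)`. -/
theorem pow_mul_add_le (b g : ℕ) : b ^ g * (b + 1 + g) ≤ (b + 1) ^ (g + 1) := by
  induction g with
  | zero => simp
  | succ g ih =>
    calc b ^ (g + 1) * (b + 1 + (g + 1)) = b ^ g * (b * (b + 1 + g) + b) := by ring
      _ ≤ b ^ g * (b * (b + 1 + g) + (b + 1 + g)) :=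
          Nat.mul_le_mul_left _ (by omega)
      _ = (b ^ g * (b + 1 + g)) * (b + 1) := by ring
      _ ≤ (b + 1) ^ (g + 1) * (b + 1) := Nat.mul_le_mul_right _ ih
      _ = (b + 1) ^ (g + 1 + 1) := by ring

/-- A busy processor is attacked by some general thief with probability at least `g / P`, where
`g` is the number of general thieves. -/
theorem card_avoiding_mul_le (s : State P) {j : Fin P} (hj : j ∈ s.busy) :
    (s.avoiding j).card * P + (Fintype.piFinset s.targets).card * s.generalThieves.card ≤
      (Fintype.piFinset s.targets).card * P := by
  have h₁ := s.card_avoiding_mul_pow hj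
  have h₂ := s.card_busy_add_card_generalThieves_le
  obtain ⟨b, hb⟩ : ∃ b, s.busy.card = b + 1 :=
    ⟨s.busy.card - 1, by have := card_pos.mpr ⟨j, hj⟩; omega⟩
  rw [hb] at h₁ h₂
  generalize (s.avoiding j).card = M at *
  generalize (Fintype.piFinset s.targets).card = N at *
  generalize s.generalThieves.card = g at *
  have h₃ : M * (b + 1 + g) ≤ N * (b + 1) := by
    refine Nat.le_of_mul_le_mul_left ?_ (Nat.pow_pos (n := g) (Nat.succ_pos b))
    calc (b + 1) ^ g * (M * (b + 1 + g)) = M * (b + 1) ^ g * (b + 1 + g) := by ring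
      _ = N * (b ^ g * (b + 1 + g)) := by rw [h₁, Nat.add_sub_cancel, mul_assoc]
      _ ≤ N * (b + 1) ^ (g + 1) := Nat.mul_le_mul_left _ (pow_mul_add_le b g)
      _ = (b + 1) ^ g * (N * (b + 1)) := by ring
  obtain ⟨d, rfl⟩ := Nat.exists_eq_add_of_le h₂
  have h₄ : M ≤ N := by
    by_contra! hlt
    have := Nat.mul_le_mul hlt (Nat.le_add_right (b + 1) g)
    nlinarith
  nlinarith [Nat.mul_le_mul_right d h₄]

/-! ### Expected decrease of the potential -/

/-- The total of `4 ^ level`. -/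
def potential (s : State P) : ℕ := s.total fun t => 4 ^ t.level

/-- A tree fails to halve only if it has a branch to offer and nobody contends for it; then in
particular no general thief has chosen its processor, and the indicator supplies the second copy of
its potential. -/
theorem two_mul_potential_next_le (s : State P) {v : Fin P → Fin P} (w : Fin P → Fin P)
    (hv : v ∈ Fintype.piFinset s.targets) :
    2 * (s.next v w).potential ≤
      ∑ i, (s.job i).elim 0 fun x => 4 ^ x.2.level * (1 + if v ∈ s.avoiding i then 1 else 0) := by
  have h := s.total_next_add_le v w (fun t => 4 ^ t.level) 0
  rw [mul_zero, add_zero] at h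
  refine le_trans (Nat.mul_le_mul_left 2 h) ?_
  rw [mul_sum]
  refine sum_le_sum fun i _ => ?_
  cases hj : s.job i with
  | none => simp
  | some x =>
    obtain ⟨o, t⟩ := x
    simp only [Option.elim_some, add_zero]
    by_cases hc : (s.contenders v i).Nonempty
    · obtain ⟨u, hu⟩ := exists_stolenBranch_of_contenders hj hc
      rw [if_pos hc, hu]
      exact (Tree.pow_level_kept_add_stolen_le hu).trans (Nat.le_mul_of_pos_right _ (by omega))
    · rw [if_neg hc]
      cases hu : t.stolenBranch with
      | none =>
        exact (Tree.pow_level_workOneStep_le_of_stolenBranch_eq_none hu).trans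
          (Nat.le_mul_of_pos_right _ (by omega))
      | some u =>
        have ha : v ∈ s.avoiding i := by
          refine mem_filter.mpr ⟨hv, fun k hk hki => hc ⟨k, ?_⟩⟩
          exact mem_filter.mpr ⟨mem_univ _, hki, by simp [loot, hj, hu], Or.inl hk⟩
        rw [if_pos ha, mul_comm 2]
        exact Nat.mul_le_mul_right 2 t.elim_workOneStep_pow_level_le

/-- The expected decrease of the potential in one timestep with `g` general thieves is by a factor
of at least `1 - g / (2 * P)`, even if the potential after the step is replaced by one when no
work is left. -/
theorem sum_max_one_potential_next_le (s : State P) (w : (Fin P → Fin P) → Fin P → Fin P) :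
    2 * P * (∑ v ∈ Fintype.piFinset s.targets, max 1 (s.next v (w v)).potential) +
        (Fintype.piFinset s.targets).card * max 1 s.potential * s.generalThieves.card ≤
      2 * P * ((Fintype.piFinset s.targets).card * max 1 s.potential) := by
  rcases s.busy.eq_empty_or_nonempty with hb | hb
  -- Without busy processors no attempts are made, and the potential after the step is zero, so the
  -- maximum with one stays at one.
  · have hg : s.generalThieves = ∅ := filter_eq_empty_iff.mpr fun i _ h => by simp [hb] at h
    have hj (i : Fin P) : s.job i = none := by
      have : i ∉ s.busy := by simp [hb]
      simpa [busy] using this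
    rw [hg, card_empty, mul_zero, add_zero]
    refine Nat.mul_le_mul_left _ ?_
    rw [← smul_eq_mul, ← sum_const]
    refine sum_le_sum fun v hv => ?_
    have := s.two_mul_potential_next_le (w v) hv
    simp only [hj, Option.elim_none, sum_const_zero] at this
    omega
  obtain ⟨i₀, hi₀⟩ := hb
  set N := (Fintype.piFinset s.targets).card
  set g := s.generalThieves.card
  have term {i : Fin P} (hi : i ∈ s.busy) : 4 ≤ (s.job i).elim 0 fun x => 4 ^ x.2.level := by
    obtain ⟨x, hx⟩ := Option.isSome_iff_exists.mp (mem_filter.mp hi).2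
    rw [hx]
    exact le_trans (by norm_num) (Nat.pow_le_pow_right (n := 4) (by norm_num) x.2.one_le_level)
  have hpot : 4 ≤ s.potential :=
    (term hi₀).trans (single_le_sum (f := fun i => (s.job i).elim 0 fun x => 4 ^ x.2.level)
      (fun _ _ => Nat.zero_le _) (mem_univ i₀))
  have hstep (v) (hv : v ∈ Fintype.piFinset s.targets) :
      2 * max 1 (s.next v (w v)).potential ≤
        ∑ i, ((s.job i).elim 0 fun x => 4 ^ x.2.level) *
          (1 + if v ∈ s.avoiding i then 1 else 0) := by
    have h₁ := s.two_mul_potential_next_le (w v) hv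
    have h₂ : (∑ i, (s.job i).elim 0 fun x =>
        4 ^ x.2.level * (1 + if v ∈ s.avoiding i then 1 else 0)) =
        ∑ i, ((s.job i).elim 0 fun x => 4 ^ x.2.level) *
          (1 + if v ∈ s.avoiding i then 1 else 0) :=
      sum_congr rfl fun i _ => by cases s.job i <;> simp
    -- This covers the case in which the maximum is one: the right side is at least `Φ ≥ 4`, because
    -- a busy processor has a tree of level at least one.
    have h₃ : s.potential ≤ ∑ i, ((s.job i).elim 0 fun x => 4 ^ x.2.level) *
          (1 + if v ∈ s.avoiding i then 1 else 0) := by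
      unfold potential total
      exact sum_le_sum fun i _ => Nat.le_mul_of_pos_right _ (Nat.lt_add_right _ one_pos)
    omega
  have hcard (i : Fin P) : (∑ v ∈ Fintype.piFinset s.targets,
      (1 + if v ∈ s.avoiding i then 1 else 0)) = N + (s.avoiding i).card := by
    rw [sum_add_distrib, sum_const, smul_eq_mul, mul_one, sum_ite_mem,
      inter_eq_right.mpr (show s.avoiding i ⊆ _ from filter_subset _ _), sum_const, smul_eq_mul, mul_one]
  have hsum : 2 * ∑ v ∈ Fintype.piFinset s.targets, max 1 (s.next v (w v)).potential ≤
      ∑ i, ((s.job i).elim 0 fun x => 4 ^ x.2.level) * (N + (s.avoiding i).card) := by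
    rw [mul_sum]
    refine (sum_le_sum hstep).trans ?_
    -- After the exchange each tree is weighted by the number of choices, with those that avoid it
    -- counted twice.
    rw [sum_comm]
    exact (sum_congr rfl fun i _ => by rw [← mul_sum, hcard]).le
  rw [max_eq_right (by omega : 1 ≤ s.potential)]
  calc 2 * P * (∑ v ∈ Fintype.piFinset s.targets, max 1 (s.next v (w v)).potential) +
        N * s.potential * g
      ≤ (∑ i, ((s.job i).elim 0 fun x => 4 ^ x.2.level) * (N + (s.avoiding i).card)) * P +
        N * s.potential * g := by
        have := Nat.mul_le_mul_right P hsum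
        linarith
    _ = ∑ i, ((s.job i).elim 0 fun x => 4 ^ x.2.level) *
          (N * P + ((s.avoiding i).card * P + N * g)) := by
        rw [potential, total, mul_sum, sum_mul, sum_mul, ← sum_add_distrib]
        exact sum_congr rfl fun i _ => by ring
    _ ≤ ∑ i, ((s.job i).elim 0 fun x => 4 ^ x.2.level) * (N * P + N * P) := by
        refine sum_le_sum fun i _ => ?_
        by_cases hi : i ∈ s.busy
        · exact Nat.mul_le_mul_left _ (Nat.add_le_add_left (s.card_avoiding_mul_le hi) _)
        · have : s.job i = none := by simpa [busy] using hi
          simp [this]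
    _ = 2 * P * (N * s.potential) := by
        rw [← sum_mul]
        change s.potential * _ = _
        ring

/-! ### The supermartingale -/

/-- The potential weighted by the number of general steals so far. -/
noncomputable def weight (s : State P) : ℝ :=
  (max 1 s.potential : ℕ) * Real.exp (s.generalSteals / (2 * P))

theorem weight_nonneg (s : State P) : 0 ≤ s.weight := by
  unfold weight
  positivity

/-- The number of general thieves is determined before the choices are made, so the exponential
factor grows by the same `exp (g / (2 P))` for every `v` and cancels the expected decay of the
potential. Letting `w` depend on `v` admits a contention rule that sees the current choices. -/
theorem sum_weight_next_le (s : State P) (w : (Fin P → Fin P) → Fin P → Fin P) (hP : 0 < P) :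
    ∑ v ∈ Fintype.piFinset s.targets, (s.next v (w v)).weight ≤
      (Fintype.piFinset s.targets).card * s.weight := by
  have hP' : (0 : ℝ) < P := by exact_mod_cast hP
  have h := s.sum_max_one_potential_next_le w
  set N := (Fintype.piFinset s.targets).card
  set g := s.generalThieves.card
  set A := ∑ v ∈ Fintype.piFinset s.targets, max 1 (s.next v (w v)).potential with hA
  have h' : (A : ℝ) ≤ N * (max 1 s.potential : ℕ) * (1 - g / (2 * P)) := by
    have h₁ : (2 * P * A + N * (max 1 s.potential : ℕ) * g : ℝ) ≤
        2 * P * (N * (max 1 s.potential : ℕ)) := by exact_mod_cast h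
    have h₂ : (N * (max 1 s.potential : ℕ) * (1 - g / (2 * P)) : ℝ) =
        (2 * P * (N * (max 1 s.potential : ℕ)) - N * (max 1 s.potential : ℕ) * g) / (2 * P) := by
      field_simp
    rw [h₂, le_div_iff₀ (by positivity)]
    linarith
  have e : ∑ v ∈ Fintype.piFinset s.targets, (s.next v (w v)).weight =
      A * Real.exp ((s.generalSteals + g) / (2 * P)) := by
    rw [hA, Nat.cast_sum, sum_mul]
    refine sum_congr rfl fun v _ => ?_
    have : (s.next v (w v)).generalSteals = s.generalSteals + g := rfl
    rw [weight, this, Nat.cast_add]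
  have hexp : (1 - g / (2 * P) : ℝ) ≤ Real.exp (-(g / (2 * P))) := by
    have := Real.add_one_le_exp (-(g / (2 * P) : ℝ))
    linarith
  rw [e]
  calc (A : ℝ) * Real.exp ((s.generalSteals + g) / (2 * P))
      ≤ N * (max 1 s.potential : ℕ) * Real.exp (-(g / (2 * P))) *
          Real.exp ((s.generalSteals + g) / (2 * P)) := by
        refine mul_le_mul_of_nonneg_right (h'.trans ?_) (Real.exp_pos _).le
        exact mul_le_mul_of_nonneg_left hexp (by positivity)
    _ = N * s.weight := by
        rw [mul_assoc, ← Real.exp_add, weight, mul_assoc]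
        congr 3
        ring

theorem tsum_choiceLaw_mul_weight_le (s : State P) (w : (Fin P → Fin P) → Fin P → Fin P)
    (hP : 0 < P) :
    ∑' v, s.choiceLaw v * ENNReal.ofReal (s.next v (w v)).weight ≤ ENNReal.ofReal s.weight := by
  have hN : (Fintype.piFinset s.targets).card ≠ 0 :=
    (card_pos.mpr (Fintype.piFinset_nonempty.mpr s.targets_nonempty)).ne'
  have e (v) : s.choiceLaw v * ENNReal.ofReal (s.next v (w v)).weight =
      if v ∈ Fintype.piFinset s.targets then
        ((Fintype.piFinset s.targets).card : ENNReal)⁻¹ * ENNReal.ofReal (s.next v (w v)).weight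
      else 0 := by
    rw [choiceLaw, PMF.uniformOfFinset_apply]
    split_ifs <;> simp
  rw [tsum_congr e, tsum_fintype, sum_ite_mem, univ_inter, ← mul_sum,
    ← ENNReal.ofReal_sum_of_nonneg fun v _ => weight_nonneg _]
  refine (mul_le_mul_right (ENNReal.ofReal_le_ofReal (s.sum_weight_next_le w hP)) _).trans ?_
  rw [ENNReal.ofReal_mul (by positivity), ENNReal.ofReal_natCast, ← mul_assoc,
    ENNReal.inv_mul_cancel (by exact_mod_cast hN) (ENNReal.natCast_ne_top _), one_mul]

end State

/-! ### The whole execution -/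

variable {P : ℕ}

/-- Once the history is given, the contention rule is a function of the current choices alone, so
the one-step inequality applies conditionally on each history. -/
theorem tsum_historyLaw_mul_weight_le (W : Computation P) (R : ContentionRule P) (hP : 0 < P)
    (n : ℕ) :
    ∑' h, historyLaw W R n h * ENNReal.ofReal (stateAfter W R h).weight ≤
      ENNReal.ofReal (initial W).weight := by
  induction n with
  | zero =>
    simp only [historyLaw, PMF.pure_apply, ite_mul, one_mul, zero_mul]
    rw [tsum_ite_eq]
    exact le_rfl
  | succ n ih =>
    refine le_trans (le_of_eq ?_) (le_trans (ENNReal.tsum_le_tsum fun h =>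
      mul_le_mul_right ((stateAfter W R h).tsum_choiceLaw_mul_weight_le
        (fun v j => R.pick h v j ((stateAfter W R h).contenders v j)) hP) _) ih)
    simp only [historyLaw, PMF.bind_apply, ← ENNReal.tsum_mul_right]
    rw [ENNReal.tsum_comm]
    refine tsum_congr fun h => ?_
    simp only [mul_assoc, ENNReal.tsum_mul_left]
    congr 1
    simp only [PMF.map_apply, ← ENNReal.tsum_mul_right]
    rw [ENNReal.tsum_comm]
    refine tsum_congr fun v => ?_
    simp only [ite_mul, zero_mul]
    rw [tsum_ite_eq]
    rfl

/-- The unspent load and the list entries are kept on the left so that both bounds are inductive.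
Restricting to the support ensures that every choice is a legal target. -/
theorem stealBacks_le_of_mem_support (W : Computation P) (R : ContentionRule P) (n : ℕ) :
    ∀ h ∈ (historyLaw W R n).support,
      (stateAfter W R h).successfulStealBacks +
          (stateAfter W R h).total (fun t => t.load - 1) ≤ W.work ∧
        (stateAfter W R h).unsuccessfulStealBacks +
          ∑ o, ((stateAfter W R h).helpers o).card ≤ (stateAfter W R h).generalSteals := by
  induction n with
  | zero =>
    intro h hh
    simp only [historyLaw, PMF.support_pure, Set.mem_singleton_iff] at hh
    subst hh
    refine ⟨?_, by simp [stateAfter, initial]⟩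
    simp only [stateAfter, initial, zero_add, State.total, Computation.work]
    refine sum_le_sum fun i _ => ?_
    cases ht : W.tree i with
    | none => simp
    | some t =>
      have := Tree.load_eq_work (W.positive i t (by simp [ht]))
      simp [this]
  | succ n ih =>
    intro h hh
    simp only [historyLaw, PMF.mem_support_bind_iff, PMF.mem_support_map_iff] at hh
    obtain ⟨h', hh', v, hv, rfl⟩ := hh
    obtain ⟨h₁, h₂⟩ := ih h' hh'
    have hv' : ∀ i, v i ∈ (stateAfter W R h').targets i := by
      rw [State.choiceLaw, PMF.mem_support_uniformOfFinset_iff] at hv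
      exact Fintype.mem_piFinset.mp hv
    exact ⟨(State.successfulStealBacks_add_total_next_le _ _ _).trans h₁,
      State.unsuccessfulStealBacks_add_helpers_next_le _ _ _ hv' h₂⟩

/-- Summing over the `P` roots costs a factor `P ≤ 4 ^ ⌈lg P⌉`, which the logarithmic term of the
span absorbs. -/
theorem potential_initial_le (W : Computation P) : (initial W).potential ≤ 4 ^ W.span := by
  have h₁ : (initial W).potential ≤ ∑ _i : Fin P, 4 ^ (W.forestHeight + W.maxSize) := by
    unfold State.potential State.total
    refine sum_le_sum fun i _ => ?_
    cases ht : W.tree i with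
    | none => simp [initial, ht]
    | some t =>
      have h₁ := Tree.level_le_height_add_maxSize (W.positive i t (by simp [ht]))
      have h₂ : t.height ≤ W.forestHeight := by
        have := le_sup (f := fun i => (W.tree i).elim 0 Tree.height) (mem_univ i)
        rwa [ht] at this
      have h₃ : t.maxSize ≤ W.maxSize := by
        have := le_sup (f := fun i => (W.tree i).elim 0 Tree.maxSize) (mem_univ i)
        rwa [ht] at this
      simp only [initial, ht, Option.map_some, Option.elim_some]
      exact Nat.pow_le_pow_right (by norm_num) (by omega)
  rw [sum_const, card_univ, Fintype.card_fin, smul_eq_mul] at h₁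
  refine h₁.trans ?_
  rw [Computation.span, add_assoc, pow_add 4 (Nat.clog 2 P)]
  refine Nat.mul_le_mul_right _ ((Nat.le_pow_clog (b := 2) (by norm_num) P).trans ?_)
  exact Nat.pow_le_pow_left (by norm_num) _

theorem weight_initial_le (W : Computation P) :
    (initial W).weight ≤ Real.exp (2 * W.span) := by
  have h₁ : max 1 (initial W).potential ≤ 4 ^ W.span :=
    max_le (Nat.one_le_pow _ _ (by norm_num)) (potential_initial_le W)
  have h₂ : (4 : ℝ) ≤ Real.exp 2 := by
    have := Real.add_one_le_exp (1 : ℝ)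
    rw [show (2 : ℝ) = 1 + 1 by norm_num, Real.exp_add]
    nlinarith
  have h₃ : (initial W).generalSteals = 0 := rfl
  rw [State.weight, h₃, Nat.cast_zero, zero_div, Real.exp_zero, mul_one, mul_comm 2,
    Real.exp_nat_mul]
  calc ((max 1 (initial W).potential : ℕ) : ℝ) ≤ (4 : ℝ) ^ W.span := by exact_mod_cast h₁
    _ ≤ _ := pow_le_pow_left₀ (by norm_num) h₂ _

/-- Markov's inequality for the weight. More than `4 P (T_∞ + L)` general steals, where `L = lg
(1/ε)`, force a weight of at least `exp (2 (T_∞ + L))`, against an expectation of at most `exp (2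
T_∞)`; the failure probability is at most `exp (-2 L) ≤ ε`. -/
theorem ofReal_one_sub_le_stealBackLaw (hP : 0 < P) (W : Computation P) (R : ContentionRule P)
    (n : ℕ) {ε : ℝ} (hε : 0 < ε) (hε₁ : ε ≤ 1) :
    ENNReal.ofReal (1 - ε) ≤ (stealBackLaw W R n).toMeasure
      {k : ℕ | (k : ℝ) ≤ W.work + 4 * (P * (W.span + Real.logb 2 (1 / ε)))} := by
  have hP' : (0 : ℝ) < P := by exact_mod_cast hP
  set L := Real.logb 2 (1 / ε) with hL
  have hlog : Real.log (1 / ε) ≤ L := by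
    have h₁ : 0 ≤ Real.log (1 / ε) := Real.log_nonneg (by rwa [le_div_iff₀ hε, one_mul])
    have h₂ : Real.log 2 ≤ 1 := by
      have := Real.log_le_sub_one_of_pos (x := 2) (by norm_num)
      linarith
    rw [hL, Real.logb, le_div_iff₀ (Real.log_pos (by norm_num))]
    exact mul_le_of_le_one_right h₁ h₂
  have hL0 : 0 ≤ L :=
    le_trans (Real.log_nonneg (by rwa [le_div_iff₀ hε, one_mul])) hlog
  set S : Set ℕ := {k : ℕ | (k : ℝ) ≤ W.work + 4 * (P * (W.span + L))} with hS
  set T : Set (History P) := (fun h => (stateAfter W R h).stealBacks) ⁻¹' S with hT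
  rw [PMF.toMeasure_apply_eq_toOuterMeasure, stealBackLaw, PMF.toOuterMeasure_map_apply,
    PMF.toOuterMeasure_apply, ← hT, ENNReal.ofReal_sub _ hε.le, ENNReal.ofReal_one,
    tsub_le_iff_right]
  set q := historyLaw W R n with hq
  have key (h : History P) : Tᶜ.indicator q h ≤
      q h * ENNReal.ofReal (stateAfter W R h).weight *
        ENNReal.ofReal (Real.exp (-(2 * (W.span + L)))) := by
    by_cases hh : h ∈ Tᶜ
    swap
    · simp [hh]
    rw [Set.indicator_of_mem hh]
    -- The two accounts hold only along possible histories; elsewhere both sides vanish.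
    by_cases hs : q h = 0
    · simp [hs]
    obtain ⟨h₁, h₂⟩ := stealBacks_le_of_mem_support W R n h ((PMF.mem_support_iff _ _).mpr hs)
    have hlt : (W.work + 4 * (P * (W.span + L)) : ℝ) < (stateAfter W R h).stealBacks :=
      not_le.mp hh
    have hle : (stateAfter W R h).stealBacks ≤ W.work + (stateAfter W R h).generalSteals := by
      unfold State.stealBacks
      omega
    have hle' : ((stateAfter W R h).stealBacks : ℝ) ≤
        W.work + (stateAfter W R h).generalSteals := by exact_mod_cast hle
    have hG : 2 * (W.span + L) ≤ (stateAfter W R h).generalSteals / (2 * P : ℝ) := by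
      rw [le_div_iff₀ (by positivity)]
      linarith
    have hw : 1 ≤ (stateAfter W R h).weight * Real.exp (-(2 * (W.span + L))) := by
      rw [State.weight, mul_assoc, ← Real.exp_add]
      -- The maximum with one in the weight is what keeps this true after all work is done.
      refine one_le_mul_of_one_le_of_one_le (by exact_mod_cast le_max_left _ _) ?_
      exact Real.one_le_exp (by linarith)
    rw [mul_assoc, ← ENNReal.ofReal_mul (State.weight_nonneg _)]
    refine le_mul_of_one_le_right' ?_
    rwa [ENNReal.one_le_ofReal]
  have hcompl : ∑' h, Tᶜ.indicator q h ≤ ENNReal.ofReal ε := by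
    refine (ENNReal.tsum_le_tsum key).trans ?_
    rw [ENNReal.tsum_mul_right]
    refine (mul_le_mul_left ((tsum_historyLaw_mul_weight_le W R hP n).trans
      (ENNReal.ofReal_le_ofReal (weight_initial_le W))) _).trans ?_
    rw [← ENNReal.ofReal_mul (Real.exp_pos _).le, ← Real.exp_add]
    refine ENNReal.ofReal_le_ofReal ?_
    rw [← Real.le_log_iff_exp_le hε]
    rw [one_div, Real.log_inv] at hlog
    linarith
  calc (1 : ENNReal) = ∑' h, q h := q.tsum_coe.symm
    _ = ∑' h, (T.indicator q h + Tᶜ.indicator q h) :=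
        tsum_congr fun h => by rw [Set.indicator_self_add_compl_apply]
    _ = ∑' h, T.indicator q h + ∑' h, Tᶜ.indicator q h := ENNReal.tsum_add
    _ ≤ _ := by gcongr

end LocalizedWorkStealing

theorem theorem5 :
    -- successful steal-backs are covered by work, unsuccessful ones by general steals
    (∀ (P : ℕ) (W : LocalizedWorkStealing.Computation P)
        (R : LocalizedWorkStealing.ContentionRule P) (n : ℕ),
        ∀ h ∈ (LocalizedWorkStealing.historyLaw W R n).support,
          (LocalizedWorkStealing.stateAfter W R h).successfulStealBacks ≤ W.work ∧
          (LocalizedWorkStealing.stateAfter W R h).unsuccessfulStealBacks ≤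
            (LocalizedWorkStealing.stateAfter W R h).generalSteals) ∧
    -- at most `T₁ + O(P T_∞)` steal-backs with probability at least `1 - P ^ (-c)`
    (∀ c : ℝ, 0 < c → ∃ C : ℝ, 0 < C ∧ ∀ (P : ℕ), 0 < P →
        ∀ (W : LocalizedWorkStealing.Computation P)
          (R : LocalizedWorkStealing.ContentionRule P) (n : ℕ),
          ENNReal.ofReal (1 - (P : ℝ) ^ (-c)) ≤
            (LocalizedWorkStealing.stealBackLaw W R n).toMeasure
              {k : ℕ | (k : ℝ) ≤ W.work + C * (P * W.span)}) ∧
    -- the same with an arbitrary failure probability and an absolute constant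
    (∃ C : ℝ, 0 < C ∧ ∀ (P : ℕ), 0 < P →
        ∀ (W : LocalizedWorkStealing.Computation P)
          (R : LocalizedWorkStealing.ContentionRule P) (n : ℕ) (ε : ℝ), 0 < ε → ε < 1 →
          ENNReal.ofReal (1 - ε) ≤
            (LocalizedWorkStealing.stealBackLaw W R n).toMeasure
              {k : ℕ | (k : ℝ) ≤ W.work + C * (P * (W.span + Real.logb 2 (1 / ε)))}) := by
  refine ⟨fun P W R n h hh => ?_, fun c hc => ⟨4 * (1 + c), by positivity, ?_⟩, 4, by norm_num, ?_⟩
  · have := LocalizedWorkStealing.stealBacks_le_of_mem_support W R n h hh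
    omega
  · intro P hP W R n
    have hP₁ : (1 : ℝ) ≤ P := by exact_mod_cast hP
    have hP₀ : (0 : ℝ) < P := by linarith
    -- Here `ε = P ^ (-c)`, which equals one for `P = 1`. Since `lg (1/ε) = c lg P ≤ c T_∞`, the
    -- constant becomes `4 (1 + c)`.
    refine (LocalizedWorkStealing.ofReal_one_sub_le_stealBackLaw hP W R n
      (Real.rpow_pos_of_pos hP₀ (-c))
      (Real.rpow_le_one_of_one_le_of_nonpos hP₁ (by linarith))).trans ?_
    refine MeasureTheory.measure_mono fun k hk => le_trans (Set.mem_ofPred.mp hk) ?_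
    have h₁ : Real.logb 2 (1 / (P : ℝ) ^ (-c)) ≤ c * W.span := by
      rw [one_div, ← Real.rpow_neg hP₀.le, neg_neg, Real.logb_rpow_eq_mul_logb_of_pos hP₀]
      refine mul_le_mul_of_nonneg_left ?_ hc.le
      have h₂ : (P : ℝ) ≤ 2 ^ (Nat.clog 2 P) := by
        exact_mod_cast Nat.le_pow_clog (by norm_num) P
      have h₃ : Real.logb 2 P ≤ Nat.clog 2 P := by
        rw [Real.logb_le_iff_le_rpow (by norm_num) hP₀, Real.rpow_natCast]
        exact h₂
      have h₄ : Nat.clog 2 P ≤ W.span := by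
        unfold LocalizedWorkStealing.Computation.span
        omega
      exact h₃.trans (by exact_mod_cast h₄)
    have h₅ := mul_le_mul_of_nonneg_left h₁ hP₀.le
    linarith
  · intro P hP W R n ε hε hε₁
    exact LocalizedWorkStealing.ofReal_one_sub_le_stealBackLaw hP W R n hε hε₁.le
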